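/- Let $P$ be a finite poset with $m$ elements $p_1,\dots,p_m$, let $n$ be a positive integer, let $A_1,\dots,A_m$ be non-empty subsets of $[n]=\{1,\dots,n\}$, and let $R=\mathbf K[X_{p,a}\mid p\in P,\ a\in[n]]$ over a field $\mathbf K$. Let $\mathrm{Hom}(P,A_1,\dots,A_m)$ be the set of isotone maps $f:P\to[n]$ with $f(p_i)\in A_i$ for all $i$, ordered pointwise; write $f$ as $(f(p_1),\dots,f(p_m))$. Let $\mathfrak A$ be a non-empty down-closed subset of $\mathrm{Hom}(P,A_1,\dots,A_m)$ and let $\mathcal L(\mathfrak A)\subseteq R$ be the ideal generated by the monomials $\prod_{i=1}^m X_{p_i,f(p_i)}$ with $f\in\mathfrak A$. For a monomial ideal $I\subseteq R$ with minimal multigraded free resolution $0\to F_p\to\cdots\to F_0\to I\to 0$, $F_t=\bigoplus_j R(-\mathbf a_{t,j})$, the $t$-th homological shift ideal $\mathrm{HS}_t(I)$ is the ideal generated by the monomials $X^{\mathbf a_{t,j}}$ for all $j$ (it is $0$ if $F_t=0$). For $K\subseteq[n]$ put $X_{p_i,K}=\prod_{a\in K}X_{p_i,a}$. Then for every integer $t\ge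 0$ the minimal set of monomial generators of $\mathrm{HS}_t(\mathcal L(\mathfrak A))$ consists of exactly the monomials $X_{p_1,K_1}X_{p_2,K_2}\cdots X_{p_m,K_m}$ such that 1. $\emptyset\ne K_i\subseteq A_i$ for all $i\in[m]$; 2. $\max K_i\le\min K_j$ whenever $p_i<p_j$; 3. $|K_1|+\cdots+|K_m|=m+t$; 4. $(\max K_1,\dots,\max K_m)\in\mathfrak A$. -/

import Mathlib

open MvPolynomial

/-! ### Generalized co-letterplace ideals -/

section CoLetterplace

variable {P : Type*} [PartialOrder P] {n : ℕ}

/-- The poset `Hom(P, 𝒜)` of isotone maps `f : P → [n]` with `f p ∈ 𝒜 p` for all `p`, ordered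
pointwise. The chain `[n]` is modelled by `Fin n`. -/
abbrev IsotoneHom (𝒜 : P → Finset (Fin n)) : Type _ :=
  {f : P →o Fin n // ∀ p, f p ∈ 𝒜 p}

/-- A poset ideal: a non-empty subset that is closed downwards. -/
def IsPosetIdeal {α : Type*} [LE α] (s : Set α) : Prop :=
  s.Nonempty ∧ IsLowerSet s

variable [Fintype P]

/-- The ideal `ℒ(𝔄)` of `k[X_{p,a} | p ∈ P, a ∈ [n]]` generated by the monomials
`U_f = ∏ p, X_{p, f p}` with `f ∈ 𝔄`. -/
noncomputable def coLetterplaceIdeal (k : Type*) [Field k] {𝒜 : P → Finset (Fin n)}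
    (𝔄 : Set (IsotoneHom 𝒜)) : Ideal (MvPolynomial (P × Fin n) k) :=
  Ideal.span {u | ∃ f ∈ 𝔄, u = ∏ p, X (p, f.1 p)}

end CoLetterplace

/-! ### Minimal multigraded free resolutions and homological shift ideals -/

section Resolution

variable {σ : Type*} {k : Type*} [Field k]

/-- `v` is homogeneous of multidegree `a` in the multigraded free module `⨁ j, R(-shift j)`,
where `R = k[X_s | s ∈ σ]`: every monomial `X^c` that occurs in the `j`-th coordinate of `v`
satisfies `c + shift j = a`. -/
def IsMultihomogeneous {r : ℕ} (shift : Fin r → σ → ℤ) (a : σ → ℤ)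
    (v : Fin r → MvPolynomial σ k) : Prop :=
  ∀ j, ∀ c ∈ (v j).support, ∀ s, (c s : ℤ) + shift j s = a s

/-- A minimal multigraded free resolution `0 → F_p → ⋯ → F_1 → F_0 → I → 0` of the ideal `I`,
with `F_i = ⨁_{j < rank i} R(-shift i j)`. -/
structure MinimalMultigradedResolution (I : Ideal (MvPolynomial σ k)) where
  /-- the rank of `F_i` -/
  rank : ℕ → ℕ
  /-- the multigraded shifts of `F_i` -/
  shift : (i : ℕ) → Fin (rank i) → σ → ℤ
  /-- the differential `F_{i+1} → F_i` -/
  d : (i : ℕ) → (Fin (rank (i + 1)) → MvPolynomial σ k) →ₗ[MvPolynomial σ k]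
    (Fin (rank i) → MvPolynomial σ k)
  /-- the augmentation `F_0 → I`, followed by the inclusion of `I` in `R` -/
  ε : (Fin (rank 0) → MvPolynomial σ k) →ₗ[MvPolynomial σ k] MvPolynomial σ k
  /-- the resolution has finite length -/
  finite_length : ∃ p, ∀ i, p < i → rank i = 0
  /-- the differentials preserve multidegrees -/
  d_graded : ∀ i a v, IsMultihomogeneous (shift (i + 1)) a v →
    IsMultihomogeneous (shift i) a (d i v)
  /-- the augmentation preserves multidegrees -/
  ε_graded : ∀ a v, IsMultihomogeneous (shift 0) a v →
    ∀ c ∈ (ε v).support, ∀ s, (c s : ℤ) = a s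
  /-- `F_0 → I` is surjective -/
  range_ε : LinearMap.range ε = I
  /-- exactness at `F_0` -/
  exact_zero : LinearMap.ker ε = LinearMap.range (d 0)
  /-- exactness at `F_{i+1}` -/
  exact_succ : ∀ i, LinearMap.ker (d i) = LinearMap.range (d (i + 1))
  /-- minimality: the image of `F_{i+1}` lies in `𝔪 F_i`, `𝔪` the ideal of all variables -/
  minimal : ∀ i v j, d i v j ∈ idealOfVars σ k

/-- The `t`-th homological shift ideal of `I`: generated by the monomials `X^c`, where `c` runs
over the `t`-th multigraded shifts of a minimal multigraded free resolution of `I` (they are the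
same for all of these, because any two are isomorphic). -/
noncomputable def homologicalShiftIdeal (t : ℕ) (I : Ideal (MvPolynomial σ k)) :
    Ideal (MvPolynomial σ k) :=
  Ideal.span {u | ∃ (F : MinimalMultigradedResolution I) (j : Fin (F.rank t)) (c : σ →₀ ℕ),
    (∀ s, F.shift t j s = (c s : ℤ)) ∧ u = monomial c 1}

/-- `S` is the minimal monomial generating set of `I`: a set of monomials that generates `I` and
is contained in every set of monomials that generates `I`. -/
def IsMinimalMonomialGeneratingSet (I : Ideal (MvPolynomial σ k)) (S : Set (MvPolynomial σ k)) :
    Prop :=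
  IsLeast {T : Set (MvPolynomial σ k) |
    (∀ u ∈ T, ∃ c : σ →₀ ℕ, u = monomial c 1) ∧ Ideal.span T = I} S

end Resolution

/-! The ideal has an explicit cellular resolution. Its cells are the sets `S` of variables `⋃ p, {p}
× K p` with `max K p ≤ min K q` for `p < q` and `(max K p)` in `𝔄`. Such a cell is a product of
simplices of dimension `∑ (|K p| - 1)`, labelled by the squarefree monomial of `S`. The differential
erases one vertex `x` and multiplies by `X x`, so its image lies in the ideal of the variables and
minimality is automatic. The cells are handled as relative simplicial chains: faces of a simplicial
complex on `P × [n]` (`IsColetterplaceFace`), modulo those that miss a fibre over `P`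
(`MeetsFibers`). The vertices of the cell complex are then the faces with `|P|` elements, and
homological degree `t` consists of the faces with `|P| + t` elements. In multidegree `a` exactness
says that the cells inside the support `B` of `a` have no reduced homology
(`exists_weightedBoundary_eq`). This is a matching argument (`isAcyclicOn_isColetterplaceFace`): let
`f₀ p` be the least value over `p` among all cells in `B`, run through `P` along a linear extension,
and match the cells that differ from `f₀` over `p` by inserting or erasing `(p, f₀ p)`. Only the
graph of `f₀` can remain. Shifts are the same for all minimal resolutions (`exists_shift_eq`), so
this one computes the homological shift ideals. The monomials found in degree `t` all have degree
`|P| + t`, so none divides another and they are the minimal generators. -/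

/-! ### Multihomogeneous components and multigraded linear maps -/

section Multigraded

variable {σ : Type*} {k : Type*} [Field k]

/-- The component of multidegree `a` of an element of `⨁ j, R(-shift j)`. -/
noncomputable def multigradedComponent {r : ℕ} (shift : Fin r → σ → ℤ) (a : σ → ℤ) :
    (Fin r → MvPolynomial σ k) →+ (Fin r → MvPolynomial σ k) :=
  letI := Classical.decEq σ
  AddMonoidHom.mk' (fun v j =>
    weightedHomogeneousComponent (fun s => (Pi.single s 1 : σ → ℤ)) (a - shift j) (v j))
    fun v w => by ext1 j; simp

theorem coeff_multigradedComponent {r : ℕ} (shift : Fin r → σ → ℤ) (a : σ → ℤ)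
    (v : Fin r → MvPolynomial σ k) (j : Fin r) (c : σ →₀ ℕ)
    [Decidable (∀ s, (c s : ℤ) + shift j s = a s)] :
    coeff c (multigradedComponent shift a v j) =
      if ∀ s, (c s : ℤ) + shift j s = a s then coeff c (v j) else 0 := by
  classical
  have hw : Finsupp.weight (fun s => (Pi.single s 1 : σ → ℤ)) c = fun s => (c s : ℤ) := by
    ext s
    rw [Finsupp.weight_apply, Finsupp.sum, Finset.sum_apply]
    simp only [Pi.smul_apply, Pi.single_apply, smul_ite, nsmul_eq_mul, mul_one, smul_zero,
      Finset.sum_ite_eq, Finsupp.mem_support_iff]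
    split_ifs with h
    · rfl
    · simp only [ne_eq, not_not] at h; simp [h]
  have h : coeff c (multigradedComponent shift a v j) =
      if Finsupp.weight (fun s => (Pi.single s 1 : σ → ℤ)) c = a - shift j
        then coeff c (v j) else 0 := by
    rw [← coeff_weightedHomogeneousComponent]
    rfl
  rw [h, hw]
  congr 1
  simp only [eq_sub_iff_add_eq, _root_.funext_iff, Pi.add_apply]

theorem isMultihomogeneous_multigradedComponent {r : ℕ} (shift : Fin r → σ → ℤ) (a : σ → ℤ)
    (v : Fin r → MvPolynomial σ k) :
    IsMultihomogeneous shift a (multigradedComponent shift a v) := by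
  classical
  intro j c hc
  rw [mem_support_iff, coeff_multigradedComponent] at hc
  exact (ite_ne_right_iff.1 hc).1

theorem IsMultihomogeneous.multigradedComponent_eq {r : ℕ} {shift : Fin r → σ → ℤ} {a b : σ → ℤ}
    {v : Fin r → MvPolynomial σ k} (hv : IsMultihomogeneous shift b v) [Decidable (a = b)] :
    multigradedComponent shift a v = if a = b then v else 0 := by
  classical
  ext1 j
  ext c
  rw [coeff_multigradedComponent]
  by_cases hc : c ∈ (v j).support
  · have := hv j c hc
    have h2 : (∀ s, (c s : ℤ) + shift j s = a s) ↔ a = b := by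
      simp only [this, _root_.funext_iff, eq_comm]
    simp only [h2]
    split_ifs <;> simp
  · rw [notMem_support_iff] at hc
    split_ifs <;> simp [hc]

theorem isMultihomogeneous_single {r : ℕ} (shift : Fin r → σ → ℤ) (j : Fin r) (c : σ →₀ ℕ)
    (x : k) : IsMultihomogeneous shift (fun s => (c s : ℤ) + shift j s)
      (Pi.single j (monomial c x)) := by
  classical
  intro i c' hc' s
  by_cases h : i = j
  · subst h
    rw [Pi.single_eq_same] at hc'
    have := support_monomial_subset hc'
    rw [Finset.mem_singleton] at this
    rw [this]
  · simp [h] at hc'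

/-- A linear map between multigraded free modules that preserves multidegrees. -/
def IsMultigraded {r r' : ℕ} (shift : Fin r → σ → ℤ) (shift' : Fin r' → σ → ℤ)
    (φ : (Fin r → MvPolynomial σ k) →ₗ[MvPolynomial σ k] (Fin r' → MvPolynomial σ k)) : Prop :=
  ∀ a v, IsMultihomogeneous shift a v → IsMultihomogeneous shift' a (φ v)

theorem IsMultigraded.map_multigradedComponent {r r' : ℕ} {shift : Fin r → σ → ℤ}
    {shift' : Fin r' → σ → ℤ}
    {φ : (Fin r → MvPolynomial σ k) →ₗ[MvPolynomial σ k] (Fin r' → MvPolynomial σ k)}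
    (hφ : IsMultigraded shift shift' φ) (a : σ → ℤ) (v : Fin r → MvPolynomial σ k) :
    φ (multigradedComponent shift a v) = multigradedComponent shift' a (φ v) := by
  classical
  have key : ∀ (j : Fin r) (p : MvPolynomial σ k),
      φ (multigradedComponent shift a (Pi.single j p)) =
        multigradedComponent shift' a (φ (Pi.single j p)) := by
    intro j p
    induction p using MvPolynomial.induction_on' with
    | monomial c x =>
      have h := isMultihomogeneous_single shift j c x
      rw [h.multigradedComponent_eq, (hφ _ _ h).multigradedComponent_eq]
      split_ifs <;> simp
    | add p q hp hq => simp only [Pi.single_add, map_add, hp, hq]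
  rw [← Finset.univ_sum_single v]
  simp only [map_sum, key]

/-- Any preimage can be replaced by its component of multidegree `a`, because `φ` commutes with
taking components. This is what makes lifts of basis vectors multigraded. -/
theorem IsMultigraded.exists_preimage {r r' : ℕ} {shift : Fin r → σ → ℤ}
    {shift' : Fin r' → σ → ℤ}
    {φ : (Fin r → MvPolynomial σ k) →ₗ[MvPolynomial σ k] (Fin r' → MvPolynomial σ k)}
    (hφ : IsMultigraded shift shift' φ) {a : σ → ℤ} {u : Fin r' → MvPolynomial σ k}
    (hu : IsMultihomogeneous shift' a u) (hr : u ∈ LinearMap.range φ) :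
    ∃ v, IsMultihomogeneous shift a v ∧ φ v = u := by
  classical
  obtain ⟨v, rfl⟩ := hr
  refine ⟨multigradedComponent shift a v, isMultihomogeneous_multigradedComponent _ _ _, ?_⟩
  rw [hφ.map_multigradedComponent, hu.multigradedComponent_eq, if_pos rfl]

/-- A linear map is multigraded if it is so on the standard basis. -/
theorem isMultigraded_of_single {r r' : ℕ} {shift : Fin r → σ → ℤ}
    {shift' : Fin r' → σ → ℤ}
    {φ : (Fin r → MvPolynomial σ k) →ₗ[MvPolynomial σ k] (Fin r' → MvPolynomial σ k)}
    (h : ∀ j, IsMultihomogeneous shift' (shift j) (φ (Pi.single j 1))) :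
    IsMultigraded shift shift' φ := by
  classical
  intro a v hv j' c hc s
  have hφ : φ v j' = ∑ j, v j * φ (Pi.single j 1) j' := by
    conv_lhs => rw [← Finset.univ_sum_single v]
    rw [map_sum, Finset.sum_apply]
    refine Finset.sum_congr rfl fun j _ => ?_
    rw [show (Pi.single j (v j) : Fin r → MvPolynomial σ k) = v j • Pi.single j 1 by
      rw [← Pi.single_smul, smul_eq_mul, mul_one], map_smul, Pi.smul_apply, smul_eq_mul]
  rw [hφ] at hc
  obtain ⟨j, -, hj⟩ := Finset.mem_biUnion.1 (support_sum hc)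
  obtain ⟨c₁, h₁, c₂, h₂, rfl⟩ := Finset.mem_add.1 (support_mul _ _ hj)
  have e₁ := hv j c₁ h₁ s
  have e₂ := h j j' c₂ h₂ s
  push_cast [Finsupp.add_apply]
  linarith

theorem exists_linearMap_single {R M : Type*} [CommRing R] [AddCommGroup M] [Module R M] {r : ℕ}
    (f : Fin r → M) : ∃ φ : (Fin r → R) →ₗ[R] M, ∀ j, φ (Pi.single j 1) = f j := by
  classical
  refine ⟨(Pi.basisFun R (Fin r)).constr ℕ f, fun j => ?_⟩
  rw [← Pi.basisFun_apply, Module.Basis.constr_basis]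

theorem linearMap_ext_single {R M : Type*} [CommRing R] [AddCommGroup M] [Module R M] {r : ℕ}
    {φ ψ : (Fin r → R) →ₗ[R] M} (h : ∀ j, φ (Pi.single j 1) = ψ (Pi.single j 1)) : φ = ψ :=
  (Pi.basisFun R (Fin r)).ext fun j => by simpa using h j

/-- Linear maps out of a finite free module lift along maps whose range contains theirs. -/
theorem exists_linearMap_comp_eq {R M N : Type*} [CommRing R] [AddCommGroup M] [Module R M]
    [AddCommGroup N] [Module R N] {r : ℕ} (φ : M →ₗ[R] N) (ψ : (Fin r → R) →ₗ[R] N)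
    (h : ∀ v, ψ v ∈ LinearMap.range φ) : ∃ χ : (Fin r → R) →ₗ[R] M, ∀ v, φ (χ v) = ψ v := by
  choose f hf using fun j : Fin r => h (Pi.single j 1)
  obtain ⟨χ, hχ⟩ := exists_linearMap_single (R := R) f
  refine ⟨χ, fun v => ?_⟩
  rw [← LinearMap.comp_apply]
  congr 1
  exact linearMap_ext_single fun j => by simp [hχ, hf]

theorem IsMultigraded.exists_linearMap_comp_eq {r r' r'' : ℕ} {shift : Fin r → σ → ℤ}
    {shift' : Fin r' → σ → ℤ} {shift'' : Fin r'' → σ → ℤ}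
    {φ : (Fin r → MvPolynomial σ k) →ₗ[MvPolynomial σ k] (Fin r' → MvPolynomial σ k)}
    {ψ : (Fin r'' → MvPolynomial σ k) →ₗ[MvPolynomial σ k] (Fin r' → MvPolynomial σ k)}
    (hφ : IsMultigraded shift shift' φ) (hψ : IsMultigraded shift'' shift' ψ)
    (h : ∀ v, ψ v ∈ LinearMap.range φ) :
    ∃ χ : (Fin r'' → MvPolynomial σ k) →ₗ[MvPolynomial σ k] (Fin r → MvPolynomial σ k),
      IsMultigraded shift'' shift χ ∧ ∀ v, φ (χ v) = ψ v := by
  have hs : ∀ j, IsMultihomogeneous shift'' (shift'' j)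
      (Pi.single j 1 : Fin r'' → MvPolynomial σ k) := fun j => by
    simpa using isMultihomogeneous_single shift'' j 0 (1 : k)
  choose f hf hf' using fun j : Fin r'' => hφ.exists_preimage (hψ _ _ (hs j)) (h (Pi.single j 1))
  obtain ⟨χ, hχ⟩ := exists_linearMap_single (R := MvPolynomial σ k) f
  refine ⟨χ, isMultigraded_of_single fun j => by rw [hχ]; exact hf j, fun v => ?_⟩
  rw [← LinearMap.comp_apply]
  congr 1
  exact linearMap_ext_single fun j => by simp [hχ, hf']

theorem map_mem_of_forall_mem {R : Type*} [CommRing R] {I : Ideal R} {r r' : ℕ}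
    (φ : (Fin r → R) →ₗ[R] (Fin r' → R)) {v : Fin r → R} (hv : ∀ j, v j ∈ I) (i : Fin r') :
    φ v i ∈ I := by
  classical
  rw [← Finset.univ_sum_single v, map_sum, Finset.sum_apply]
  refine Ideal.sum_mem _ fun j _ => ?_
  rw [show (Pi.single j (v j) : Fin r → R) = v j • Pi.single j 1 by
    rw [← Pi.single_smul, smul_eq_mul, mul_one], map_smul, Pi.smul_apply, smul_eq_mul]
  exact Ideal.mul_mem_right _ _ (hv j)

theorem mem_idealOfVars_iff_coeff_zero {p : MvPolynomial σ k} :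
    p ∈ idealOfVars σ k ↔ coeff 0 p = 0 := by
  rw [← pow_one (idealOfVars σ k), mem_pow_idealOfVars_iff']
  constructor
  · intro h
    exact h 0 (by simp)
  · intro h x hx
    have : x = 0 := by
      rw [Nat.lt_one_iff] at hx
      exact (Finsupp.degree_eq_zero_iff x).1 hx
    rw [this, h]

end Multigraded

/-! ### Uniqueness of the shifts of a minimal resolution -/

namespace MinimalMultigradedResolution

variable {σ : Type*} {k : Type*} [Field k] {I : Ideal (MvPolynomial σ k)}

/-- The cycles in homological degree `t`. -/
noncomputable def cycles (F : MinimalMultigradedResolution I) : (t : ℕ) →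
    Submodule (MvPolynomial σ k) (Fin (F.rank t) → MvPolynomial σ k)
  | 0 => LinearMap.ker F.ε
  | t + 1 => LinearMap.ker (F.d t)

theorem cycles_eq_range (F : MinimalMultigradedResolution I) (t : ℕ) :
    F.cycles t = LinearMap.range (F.d t) := by
  cases t with
  | zero => exact F.exact_zero
  | succ t => exact F.exact_succ t

theorem d_mem_cycles (F : MinimalMultigradedResolution I) (t : ℕ)
    (v : Fin (F.rank (t + 1)) → MvPolynomial σ k) : F.d t v ∈ F.cycles t := by
  rw [cycles_eq_range]; exact ⟨v, rfl⟩

theorem d_d (F : MinimalMultigradedResolution I) (t : ℕ)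
    (v : Fin (F.rank (t + 2)) → MvPolynomial σ k) : F.d t (F.d (t + 1) v) = 0 :=
  F.d_mem_cycles (t + 1) v

variable (F G : MinimalMultigradedResolution I)

theorem exists_multigraded_lift_ε :
    ∃ α : (Fin (F.rank 0) → MvPolynomial σ k) →ₗ[MvPolynomial σ k]
        (Fin (G.rank 0) → MvPolynomial σ k),
      IsMultigraded (F.shift 0) (G.shift 0) α ∧ ∀ v, G.ε (α v) = F.ε v := by
  have h (H : MinimalMultigradedResolution I) : IsMultigraded (H.shift 0) (fun _ : Fin 1 => 0)
      (LinearMap.pi fun _ => H.ε) := by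
    intro a v hv j c hc s
    simpa using H.ε_graded a v hv c hc s
  obtain ⟨α, hα, hα'⟩ := (h G).exists_linearMap_comp_eq (h F) (fun v => by
    have : F.ε v ∈ LinearMap.range G.ε := G.range_ε.symm ▸ F.range_ε.le ⟨v, rfl⟩
    obtain ⟨w, hw⟩ := this
    exact ⟨w, funext fun _ => hw⟩)
  exact ⟨α, hα, fun v => congrFun (hα' v) 0⟩

theorem exists_multigraded_lift (t : ℕ)
    (α : (Fin (F.rank t) → MvPolynomial σ k) →ₗ[MvPolynomial σ k]
        (Fin (G.rank t) → MvPolynomial σ k))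
    (hα : IsMultigraded (F.shift t) (G.shift t) α) (hc : ∀ v ∈ F.cycles t, α v ∈ G.cycles t) :
    ∃ α' : (Fin (F.rank (t + 1)) → MvPolynomial σ k) →ₗ[MvPolynomial σ k]
        (Fin (G.rank (t + 1)) → MvPolynomial σ k),
      IsMultigraded (F.shift (t + 1)) (G.shift (t + 1)) α' ∧
      ∀ v, G.d t (α' v) = α (F.d t v) :=
  IsMultigraded.exists_linearMap_comp_eq (G.d_graded t)
    (ψ := α ∘ₗ F.d t) (fun a v hv => hα a _ (F.d_graded t a v hv))
    (fun v => by rw [← cycles_eq_range]; exact hc _ (F.d_mem_cycles t v))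

/-- Two minimal multigraded resolutions of the same ideal admit a comparison map. -/
theorem exists_comparison :
    ∃ α : (t : ℕ) → (Fin (F.rank t) → MvPolynomial σ k) →ₗ[MvPolynomial σ k]
        (Fin (G.rank t) → MvPolynomial σ k),
      (∀ t, IsMultigraded (F.shift t) (G.shift t) (α t)) ∧ (∀ v, G.ε (α 0 v) = F.ε v) ∧
      ∀ t v, G.d t (α (t + 1) v) = α t (F.d t v) := by
  obtain ⟨α₀, h₀, h₀'⟩ := exists_multigraded_lift_ε F G
  -- Preservation of cycles is carried along the recursion, since it is what makes the next lift
  -- possible.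
  let S (t : ℕ) := {α : (Fin (F.rank t) → MvPolynomial σ k) →ₗ[MvPolynomial σ k]
        (Fin (G.rank t) → MvPolynomial σ k) //
        IsMultigraded (F.shift t) (G.shift t) α ∧ ∀ v ∈ F.cycles t, α v ∈ G.cycles t}
  have step (t : ℕ) (α : S t) : ∃ α' : S (t + 1), ∀ v, G.d t (α'.1 v) = α.1 (F.d t v) := by
    obtain ⟨α', h₁, h₂⟩ := exists_multigraded_lift F G t α.1 α.2.1 α.2.2
    refine ⟨⟨α', h₁, fun v hv => ?_⟩, h₂⟩
    have hv' : F.d t v = 0 := hv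
    change G.d t (α' v) = 0
    rw [h₂, hv', map_zero]
  choose next hnext using step
  let seq (t : ℕ) : S t := Nat.rec ⟨α₀, h₀, fun v hv => by
    have hv' : F.ε v = 0 := hv
    change G.ε (α₀ v) = 0
    rw [h₀', hv']⟩ next t
  exact ⟨fun t => (seq t).1, fun t => (seq t).2.1, h₀', fun t => hnext t (seq t)⟩

/-- A chain endomorphism of a minimal resolution that lifts `0` vanishes modulo the variables. -/
theorem apply_mem_idealOfVars_of_lift_zero
    (γ : (t : ℕ) → (Fin (F.rank t) → MvPolynomial σ k) →ₗ[MvPolynomial σ k]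
        (Fin (F.rank t) → MvPolynomial σ k))
    (h₀ : ∀ v, F.ε (γ 0 v) = 0) (h : ∀ t v, F.d t (γ (t + 1) v) = γ t (F.d t v)) (t : ℕ) :
    (∃ η : (Fin (F.rank t) → MvPolynomial σ k) →ₗ[MvPolynomial σ k]
        (Fin (F.rank (t + 1)) → MvPolynomial σ k),
      ∀ v, γ t (F.d t v) = F.d t (η (F.d t v))) ∧
    ∀ v j, γ t v j ∈ idealOfVars σ k := by
  induction t with
  | zero =>
    obtain ⟨η, hη⟩ := exists_linearMap_comp_eq (F.d 0) (γ 0) (fun v => by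
      rw [← F.exact_zero]; exact h₀ v)
    exact ⟨⟨η, fun v => (hη _).symm⟩, fun v j => by rw [← hη]; exact F.minimal _ _ _⟩
  | succ t ih =>
    obtain ⟨⟨η, hη⟩, -⟩ := ih
    -- The usual null-homotopy: `γ - η ∘ d` takes values in cycles, hence lifts to `η'`, and `γ = d
    -- ∘ η' + η ∘ d` has image in `𝔪 F` by minimality.
    obtain ⟨η', hη'⟩ := exists_linearMap_comp_eq (F.d (t + 1)) (γ (t + 1) - η ∘ₗ F.d t) (fun v => by
      rw [← F.exact_succ, LinearMap.mem_ker, LinearMap.sub_apply, map_sub, h, hη,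
        LinearMap.comp_apply, sub_self])
    have hγ (v) : γ (t + 1) v = F.d (t + 1) (η' v) + η (F.d t v) := by
      rw [hη', LinearMap.sub_apply, LinearMap.comp_apply, sub_add_cancel]
    refine ⟨⟨η', fun v => ?_⟩, fun v j => ?_⟩
    · rw [hγ, d_d, map_zero, add_zero]
    · rw [hγ]
      exact Ideal.add_mem _ (F.minimal _ _ _) (map_mem_of_forall_mem η (F.minimal t v) j)

/-- The multigraded shifts of a minimal multigraded resolution do not depend on the resolution. -/
theorem exists_shift_eq (t : ℕ) (j : Fin (F.rank t)) : ∃ i, G.shift t i = F.shift t j := by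
  classical
  obtain ⟨α, hα, hα₀, hα'⟩ := exists_comparison F G
  obtain ⟨β, -, hβ₀, hβ'⟩ := exists_comparison G F
  have hγ := (apply_mem_idealOfVars_of_lift_zero F (fun t => β t ∘ₗ α t - LinearMap.id)
    (fun v => by simp [hα₀, hβ₀]) (fun t v => by simp [hα', hβ']) t).2 (Pi.single j 1)
  -- Since `β ∘ α - id` vanishes modulo the variables, `α` cannot send a basis vector into `𝔪 G`. A
  -- coordinate with nonzero constant term then forces equal shifts, as `α` preserves multidegrees.
  have hα1 : ¬ ∀ i, α t (Pi.single j 1) i ∈ idealOfVars σ k := by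
    intro hm
    have h1 := Ideal.sub_mem _ (map_mem_of_forall_mem (β t) hm j) (hγ j)
    simp only [LinearMap.sub_apply, LinearMap.comp_apply, LinearMap.id_apply, Pi.sub_apply,
      sub_sub_cancel, Pi.single_eq_same] at h1
    rw [mem_idealOfVars_iff_coeff_zero] at h1
    simp at h1
  push Not at hα1
  obtain ⟨i, hi⟩ := hα1
  rw [mem_idealOfVars_iff_coeff_zero, ← ne_eq, ← mem_support_iff] at hi
  have h1 := isMultihomogeneous_single (F.shift t) j 0 (1 : k)
  have h2 := hα t _ _ h1 i 0 hi
  refine ⟨i, funext fun s => ?_⟩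
  simpa using h2 s

end MinimalMultigradedResolution

/-! ### Relative simplicial chains, cones and matchings -/

section SignedBoundary

variable {V : Type*} [Fintype V] [DecidableEq V] {A : Type*} [CommRing A]

/-- The sign with which `T` occurs in the boundary of `insert x T`, for `V` ordered by `ρ`. -/
def boundarySign (A : Type*) [CommRing A] (ρ : V → ℕ) (x : V) (T : Finset V) : A :=
  (-1) ^ (T.filter fun y => ρ y < ρ x).card

/-- The boundary operator of the full simplex on `V`, with weights `ω` on the vertices. A chain is
given by its coefficients. -/
def weightedBoundary (ρ : V → ℕ) (ω : V → A) : (Finset V → A) →ₗ[A] (Finset V → A) where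
  toFun v T := ∑ x ∈ Tᶜ, boundarySign A ρ x T * (ω x * v (insert x T))
  map_add' v w := by
    ext T
    simp only [Pi.add_apply, mul_add, Finset.sum_add_distrib]
  map_smul' c v := by
    ext T
    simp only [Pi.smul_apply, smul_eq_mul, RingHom.id_apply, Finset.mul_sum]
    exact Finset.sum_congr rfl fun x _ => by ring

variable {ρ : V → ℕ} {ω : V → A}

theorem weightedBoundary_apply (v : Finset V → A) (T : Finset V) :
    weightedBoundary ρ ω v T = ∑ x ∈ Tᶜ, boundarySign A ρ x T * (ω x * v (insert x T)) := rfl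

/-- The boundary at `T` reads only the cofaces of `T`. Hence, for `N` closed under supersets,
boundaries at cells in `N` ignore all values outside `N`, which gives relative chains without
passing to a quotient. -/
theorem weightedBoundary_congr {v w : Finset V → A} {T : Finset V}
    (h : ∀ x ∉ T, v (insert x T) = w (insert x T)) :
    weightedBoundary ρ ω v T = weightedBoundary ρ ω w T :=
  Finset.sum_congr rfl fun x hx => by rw [h x (Finset.mem_compl.1 hx)]

omit [Fintype V] [DecidableEq V] in
theorem boundarySign_mul_self (x : V) (T : Finset V) :
    boundarySign A ρ x T * boundarySign A ρ x T = 1 := by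
  rw [boundarySign, ← mul_pow]; simp

omit [Fintype V] in
theorem boundarySign_insert {x y : V} {T : Finset V} (hy : y ∉ T) :
    boundarySign A ρ x (insert y T) =
      (if ρ y < ρ x then -1 else 1) * boundarySign A ρ x T := by
  rw [boundarySign, boundarySign, Finset.filter_insert]
  split_ifs with h
  · rw [Finset.card_insert_of_notMem (by simp [hy]), pow_succ, mul_comm]
  · rw [one_mul]

omit [Fintype V] in
theorem boundarySign_swap (hρ : Function.Injective ρ) {x y : V} (hxy : x ≠ y) {T : Finset V}
    (hx : x ∉ T) (hy : y ∉ T) :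
    boundarySign A ρ x T * boundarySign A ρ y (insert x T) =
      - (boundarySign A ρ y T * boundarySign A ρ x (insert y T)) := by
  rw [boundarySign_insert hx, boundarySign_insert hy]
  rcases lt_or_gt_of_ne (hρ.ne hxy) with h | h
  · rw [if_pos h, if_neg h.not_gt]; ring
  · rw [if_neg h.not_gt, if_pos h]; ring

theorem weightedBoundary_weightedBoundary (hρ : Function.Injective ρ) (v : Finset V → A) :
    weightedBoundary ρ ω (weightedBoundary ρ ω v) = 0 := by
  ext T
  simp only [weightedBoundary_apply, Finset.mul_sum, Pi.zero_apply]
  rw [Finset.sum_sigma']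
  refine Finset.sum_involution (fun p _ => ⟨p.2, p.1⟩) ?_ ?_ ?_ ?_
  · rintro ⟨x, y⟩ h
    simp only [Finset.mem_sigma, Finset.mem_compl, Finset.mem_insert, not_or] at h
    have := boundarySign_swap (A := A) hρ (Ne.symm h.2.1) h.1 h.2.2
    rw [Finset.insert_comm x y]
    linear_combination (ω x * ω y * v (insert y (insert x T))) * this
  · rintro ⟨x, y⟩ h - he
    simp only [Finset.mem_sigma, Finset.mem_compl, Finset.mem_insert, not_or] at h
    simp only [Sigma.mk.injEq, heq_eq_eq] at he
    exact h.2.1 he.1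
  · rintro ⟨x, y⟩ h
    simp only [Finset.mem_sigma, Finset.mem_compl, Finset.mem_insert, not_or] at h ⊢
    exact ⟨h.2.2, Ne.symm h.2.1, h.1⟩
  · rintro ⟨x, y⟩ h
    rfl

/-- The cone operator with apex `x₀`. -/
def coneOperator (ρ : V → ℕ) (x₀ : V) (v : Finset V → A) (S : Finset V) : A :=
  if x₀ ∈ S then boundarySign A ρ x₀ (S.erase x₀) * v (S.erase x₀) else 0

/-- Together with the next lemma this is the homotopy identity `∂c + c∂ = id` for the cone `c`; the
term `c∂` vanishes at faces without the apex. -/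
theorem weightedBoundary_coneOperator_of_notMem (v : Finset V → A) {x₀ : V}
    {T : Finset V} (h : x₀ ∉ T) :
    weightedBoundary ρ 1 (coneOperator ρ x₀ v) T = v T := by
  rw [weightedBoundary_apply, Finset.sum_eq_single x₀]
  · simp only [coneOperator, Finset.mem_insert_self, if_true, Finset.erase_insert h, Pi.one_apply,
      one_mul, ← mul_assoc, boundarySign_mul_self]
  · intro x _ hx
    simp [coneOperator, h, Ne.symm hx]
  · intro h'
    simp [h] at h'

theorem weightedBoundary_coneOperator_of_mem (hρ : Function.Injective ρ) (v : Finset V → A) {x₀ : V}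
    {T : Finset V} (h : x₀ ∈ T) :
    weightedBoundary ρ 1 (coneOperator ρ x₀ v) T =
      v T - boundarySign A ρ x₀ (T.erase x₀) * weightedBoundary ρ 1 v (T.erase x₀) := by
  obtain ⟨U, hU, rfl⟩ : ∃ U, x₀ ∉ U ∧ T = insert x₀ U :=
    ⟨T.erase x₀, Finset.notMem_erase _ _, (Finset.insert_erase h).symm⟩
  rw [Finset.erase_insert hU, weightedBoundary_apply, weightedBoundary_apply]
  have hc : Uᶜ = insert x₀ (insert x₀ U)ᶜ := by
    ext y
    by_cases hy : y = x₀ <;> simp [hy, hU]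
  rw [hc, Finset.sum_insert (by simp), mul_add]
  simp only [Pi.one_apply, one_mul, ← mul_assoc, boundarySign_mul_self]
  rw [sub_add_cancel_left, Finset.mul_sum, ← Finset.sum_neg_distrib]
  refine Finset.sum_congr rfl fun x hx => ?_
  simp only [Finset.mem_compl, Finset.mem_insert, not_or] at hx
  rw [coneOperator, if_pos (by simp), Finset.insert_comm x x₀,
    Finset.erase_insert (by simp [hU, Ne.symm hx.1])]
  rw [boundarySign_insert hU, boundarySign_insert hx.2]
  rcases lt_or_gt_of_ne (hρ.ne hx.1) with h | h
  · rw [if_pos h, if_neg h.not_gt]; ring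
  · rw [if_neg h.not_gt, if_pos h]; ring

/-- Summing the boundary of a chain over the faces of least dimension gives zero, provided that
this holds for the single cells. -/
theorem sum_weightedBoundary_eq_zero {N : Finset V → Prop} [DecidablePred N] {m : ℕ}
    (hN : ∀ ⦃S T⦄, S ⊆ T → N S → N T)
    (hm : ∀ S, N S → S.card = m + 1 →
      ∑ x ∈ S, (if N (S.erase x) then boundarySign A ρ x (S.erase x) else 0) = 0)
    (v : Finset V → A) :
    ∑ T with N T ∧ T.card = m, weightedBoundary ρ ω v T * ∏ x ∈ T, ω x = 0 := by
  have h : ∑ T with N T ∧ T.card = m, weightedBoundary ρ ω v T * ∏ x ∈ T, ω x =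
      ∑ S with N S ∧ S.card = m + 1, ∑ x ∈ S, v S * (∏ y ∈ S, ω y) *
        (if N (S.erase x) then boundarySign A ρ x (S.erase x) else 0) := by
    have h' : ∀ S ∈ Finset.univ.filter (fun S : Finset V => N S ∧ S.card = m + 1),
        ∑ x ∈ S, v S * (∏ y ∈ S, ω y) *
          (if N (S.erase x) then boundarySign A ρ x (S.erase x) else 0) =
        ∑ x ∈ S with N (S.erase x), v S * (∏ y ∈ S, ω y) * boundarySign A ρ x (S.erase x) := by
      intro S _
      rw [Finset.sum_filter]
      exact Finset.sum_congr rfl fun x _ => by split_ifs <;> simp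
    rw [Finset.sum_congr rfl h']
    simp only [weightedBoundary_apply, Finset.sum_mul]
    rw [Finset.sum_sigma', Finset.sum_sigma']
    refine Finset.sum_bij' (fun p _ => ⟨insert p.2 p.1, p.2⟩) (fun p _ => ⟨p.1.erase p.2, p.2⟩)
      ?_ ?_ ?_ ?_ ?_
    · rintro ⟨T, x⟩ h
      simp only [Finset.mem_sigma, Finset.mem_filter, Finset.mem_univ, true_and,
        Finset.mem_compl] at h ⊢
      refine ⟨⟨hN (Finset.subset_insert _ _) h.1.1, ?_⟩, Finset.mem_insert_self _ _, ?_⟩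
      · rw [Finset.card_insert_of_notMem h.2, h.1.2]
      · rw [Finset.erase_insert h.2]; exact h.1.1
    · rintro ⟨S, x⟩ h
      simp only [Finset.mem_sigma, Finset.mem_filter, Finset.mem_univ, true_and,
        Finset.mem_compl] at h ⊢
      refine ⟨⟨h.2.2, ?_⟩, Finset.notMem_erase _ _⟩
      rw [Finset.card_erase_of_mem h.2.1, h.1.2, Nat.add_sub_cancel]
    · rintro ⟨T, x⟩ h
      simp only [Finset.mem_sigma, Finset.mem_compl] at h
      simp [Finset.erase_insert h.2]
    · rintro ⟨S, x⟩ h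
      simp only [Finset.mem_sigma, Finset.mem_filter] at h
      simp [Finset.insert_erase h.2.1]
    · rintro ⟨T, x⟩ h
      simp only [Finset.mem_sigma, Finset.mem_compl] at h
      simp only [Finset.erase_insert h.2, Finset.prod_insert h.2]
      ring
  rw [h]
  refine Finset.sum_eq_zero fun S hS => ?_
  simp only [Finset.mem_filter, Finset.mem_univ, true_and] at hS
  rw [← Finset.mul_sum, hm S hS.1 hS.2, mul_zero]

/-- The chain complex with coefficients in `A` on the members `S` of the simplicial complex `L`
with `N S`, where `N` is closed under supersets and its least members have `m` elements, is exact
as an augmented complex. -/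
def IsAcyclicOn (A : Type*) [CommRing A] (ρ : V → ℕ) (N : Finset V → Prop) [DecidablePred N]
    (m : ℕ) (L : Finset V → Prop) : Prop :=
  ∀ v : Finset V → A, (∀ S, ¬ L S → v S = 0) → (∀ T, N T → weightedBoundary ρ 1 v T = 0) →
    ∑ S with N S ∧ S.card = m, v S = 0 →
    ∃ w : Finset V → A, (∀ S, ¬ L S → w S = 0) ∧ ∀ T, N T → weightedBoundary ρ 1 w T = v T

/-- If the cells of `L` outside of a subcomplex `L₁` are matched by inserting and erasing a vertex
`x₀`, then acyclicity of `L₁` implies that of `L`. -/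
theorem IsAcyclicOn.of_matching {N : Finset V → Prop} [DecidablePred N] {m : ℕ}
    (hρ : Function.Injective ρ) (hN : ∀ ⦃S T⦄, S ⊆ T → N S → N T)
    (hm : ∀ S, N S → S.card = m + 1 →
      ∑ x ∈ S, (if N (S.erase x) then boundarySign A ρ x (S.erase x) else 0) = 0)
    {L L₁ : Finset V → Prop} (hL : ∀ ⦃S T⦄, S ⊆ T → L T → L S)
    (hL₁ : ∀ ⦃S T⦄, S ⊆ T → L₁ T → L₁ S) (hle : ∀ S, L₁ S → L S) (x₀ : V)
    (hx₀ : ∀ S, N S → L S → ¬ L₁ S →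
      L (insert x₀ S) ∧ N (S.erase x₀) ∧ ¬ L₁ (S.erase x₀))
    (h : IsAcyclicOn A ρ N m L₁) : IsAcyclicOn A ρ N m L := by
  classical
  intro v hvL hvN hv0
  set v₂ : Finset V → A := fun S => if N S ∧ ¬ L₁ S then v S else 0 with hv₂
  set w := coneOperator ρ x₀ v₂ with hw
  have hwL : ∀ S, ¬ L S → w S = 0 := by
    intro S hS
    rw [hw, coneOperator]
    split_ifs with hxS
    · have : v₂ (S.erase x₀) = 0 := by
        by_contra hne
        rw [hv₂] at hne
        simp only [ite_eq_right_iff, Classical.not_imp] at hne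
        have hL' : L (S.erase x₀) := by
          by_contra hc
          exact hne.2 (hvL _ hc)
        have := (hx₀ _ hne.1.1 hL' hne.1.2).1
        rw [Finset.insert_erase hxS] at this
        exact hS this
      rw [this, mul_zero]
    · rfl
  have hdw : ∀ T, N T → ¬ L₁ T → weightedBoundary ρ 1 w T = v T := by
    intro T hNT hT
    by_cases hLT : L T
    swap
    · rw [hvL T hLT, weightedBoundary_apply]
      refine Finset.sum_eq_zero fun x _ => ?_
      rw [hwL _ fun hc => hLT (hL (Finset.subset_insert _ _) hc), mul_zero, mul_zero]
    have hv₂T : v₂ T = v T := by rw [hv₂]; exact if_pos ⟨hNT, hT⟩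
    by_cases hxT : x₀ ∈ T
    · obtain ⟨-, hNU, hU⟩ := hx₀ T hNT hLT hT
      rw [hw, weightedBoundary_coneOperator_of_mem hρ _ hxT, hv₂T]
      -- All cofaces of `T.erase x₀` satisfy `N` and lie outside `L₁`, so `v₂` and `v` agree on them
      -- and the cycle condition for `v` applies.
      rw [weightedBoundary_congr (w := v), hvN _ hNU, mul_zero, sub_zero]
      intro x _
      rw [hv₂]
      exact if_pos ⟨hN (Finset.subset_insert _ _) hNU,
        fun hc => hU (hL₁ (Finset.subset_insert _ _) hc)⟩
    · rw [hw, weightedBoundary_coneOperator_of_notMem _ hxT, hv₂T]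
  -- Subtracting the boundary of the cone `w` pushes the cycle into `L₁`, where the hypothesis fills
  -- it.
  set v₁ : Finset V → A := fun S => if L₁ S then v S - weightedBoundary ρ 1 w S else 0 with hv₁
  have hv₁N : ∀ T, N T → v₁ T = v T - weightedBoundary ρ 1 w T := by
    intro T hT
    rw [hv₁]
    simp only
    split_ifs with h1
    · rfl
    · rw [hdw T hT h1, sub_self]
  obtain ⟨w₁, hw₁, hw₁'⟩ := h v₁ (fun S hS => if_neg hS) (fun T hT => by
      rw [weightedBoundary_congr (w := v - weightedBoundary ρ 1 w), map_sub, Pi.sub_apply, hvN T hT,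
        weightedBoundary_weightedBoundary hρ, Pi.zero_apply, sub_zero]
      intro x _
      exact hv₁N _ (hN (Finset.subset_insert _ _) hT)) (by
      have h1 := sum_weightedBoundary_eq_zero (ω := 1) hN hm w
      simp only [Pi.one_apply, Finset.prod_const_one, mul_one] at h1
      calc ∑ S with N S ∧ S.card = m, v₁ S
          = ∑ S with N S ∧ S.card = m, v S -
              ∑ S with N S ∧ S.card = m, weightedBoundary ρ 1 w S := by
            rw [← Finset.sum_sub_distrib]
            exact Finset.sum_congr rfl fun T hT => hv₁N T (Finset.mem_filter.1 hT).2.1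
        _ = 0 := by rw [hv0, h1, sub_zero])
  refine ⟨w + w₁, fun S hS => ?_, fun T hT => ?_⟩
  · rw [Pi.add_apply, hwL S hS, hw₁ S fun hc => hS (hle S hc), add_zero]
  · rw [map_add, Pi.add_apply, hw₁' T hT, hv₁N T hT, add_sub_cancel]

end SignedBoundary

/-! ### Reduction to single multidegrees -/

section Strand

variable {V : Type*} [Fintype V] [DecidableEq V] {k : Type*} [Field k]

/-- The exponent vector of the squarefree monomial with support `S`. -/
noncomputable def squarefreeExponent (S : Finset V) : V →₀ ℕ := ∑ x ∈ S, Finsupp.single x 1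

omit [Fintype V] in
theorem squarefreeExponent_apply (S : Finset V) (x : V) :
    squarefreeExponent S x = if x ∈ S then 1 else 0 := by
  simp [squarefreeExponent, Finsupp.finsetSum_apply, Finsupp.single_apply]

omit [Fintype V] in
theorem squarefreeExponent_insert {S : Finset V} {x : V} (hx : x ∉ S) :
    squarefreeExponent (insert x S) = squarefreeExponent S + Finsupp.single x 1 := by
  rw [squarefreeExponent, Finset.sum_insert hx, add_comm]; rfl

omit [Fintype V] in
theorem squarefreeExponent_le_iff {S : Finset V} {a : V →₀ ℕ} :
    squarefreeExponent S ≤ a ↔ S ⊆ a.support := by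
  constructor
  · intro h x hx
    have := h x
    rw [squarefreeExponent_apply, if_pos hx] at this
    rw [Finsupp.mem_support_iff]; omega
  · intro h x
    rw [squarefreeExponent_apply]
    split_ifs with hx
    · have := Finsupp.mem_support_iff.1 (h hx); omega
    · exact Nat.zero_le _

omit [Fintype V] [DecidableEq V] in
theorem monomial_squarefreeExponent (S : Finset V) :
    monomial (squarefreeExponent S) (1 : k) = ∏ x ∈ S, X x := by
  rw [squarefreeExponent, monomial_sum_one]; rfl

omit [Fintype V] [DecidableEq V] in
theorem boundarySign_mvPolynomial (ρ : V → ℕ) (x : V) (T : Finset V) :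
    boundarySign (MvPolynomial V k) ρ x T = C (boundarySign k ρ x T) := by
  simp [boundarySign]

/-- The strand of multidegree `a` of a chain with polynomial coefficients. -/
noncomputable def strand (v : Finset V → MvPolynomial V k) (a : V →₀ ℕ) (S : Finset V) : k :=
  if S ⊆ a.support then coeff (a - squarefreeExponent S) (v S) else 0

/-- The weight `X x` only shifts exponents, which the passage from `T` to `insert x T` compensates;
in a fixed multidegree all weights become `1`. -/
theorem weightedBoundary_strand {ρ : V → ℕ} (v : Finset V → MvPolynomial V k) {a : V →₀ ℕ}
    {T : Finset V} (hT : T ⊆ a.support) :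
    weightedBoundary ρ 1 (strand v a) T =
      coeff (a - squarefreeExponent T) (weightedBoundary ρ X v T) := by
  rw [weightedBoundary_apply, weightedBoundary_apply, coeff_sum]
  refine Finset.sum_congr rfl fun x hx => ?_
  rw [Finset.mem_compl] at hx
  rw [boundarySign_mvPolynomial, coeff_C_mul, coeff_X_mul', Pi.one_apply, one_mul, strand]
  have h : x ∈ (a - squarefreeExponent T).support ↔ insert x T ⊆ a.support := by
    rw [Finset.insert_subset_iff, and_iff_left hT, Finsupp.mem_support_iff, Finsupp.mem_support_iff,
      Finsupp.tsub_apply, squarefreeExponent_apply, if_neg hx, Nat.sub_zero]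
  simp only [h, squarefreeExponent_insert hx, tsub_tsub]

/-- A chain complex with polynomial coefficients is exact if its strands are. -/
theorem exists_weightedBoundary_eq {ρ : V → ℕ} {N : Finset V → Prop} [DecidablePred N] {m : ℕ}
    {L : Finset V → Prop} (hA : ∀ B, IsAcyclicOn k ρ N m fun S => L S ∧ S ⊆ B)
    (v : Finset V → MvPolynomial V k) (hvL : ∀ S, ¬ L S → v S = 0)
    (hvN : ∀ T, N T → weightedBoundary ρ X v T = 0)
    (hv0 : ∑ S with N S ∧ S.card = m, v S * ∏ x ∈ S, X x = 0) :
    ∃ w : Finset V → MvPolynomial V k, (∀ S, ¬ L S → w S = 0) ∧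
      ∀ T, N T → weightedBoundary ρ X w T = v T := by
  classical
  have hstrand (a : V →₀ ℕ) : ∃ w : Finset V → k, (∀ S, ¬ (L S ∧ S ⊆ a.support) → w S = 0) ∧
      ∀ T, N T → weightedBoundary ρ 1 w T = strand v a T := by
    refine hA a.support (strand v a) (fun S hS => ?_) (fun T hT => ?_) ?_
    · rw [strand]
      split_ifs with h
      · rw [hvL S fun hc => hS ⟨hc, h⟩, coeff_zero]
      · rfl
    · by_cases h : T ⊆ a.support
      · rw [weightedBoundary_strand v h, hvN T hT, coeff_zero]
      · rw [weightedBoundary_apply]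
        refine Finset.sum_eq_zero fun x _ => ?_
        rw [strand, if_neg fun hc => h ((Finset.subset_insert _ _).trans hc), mul_zero, mul_zero]
    · have h := congrArg (coeff a) hv0
      rw [coeff_sum, coeff_zero] at h
      rw [← h]
      refine Finset.sum_congr rfl fun S _ => ?_
      rw [← monomial_squarefreeExponent, coeff_mul_monomial', mul_one, strand]
      simp only [squarefreeExponent_le_iff]
  choose w hwL hwd using hstrand
  -- Only the finitely many multidegrees that occur in `v` need to be filled. The solutions are then
  -- glued; truncated subtraction of exponents is harmless, since `w a S` vanishes unless `S` lies
  -- in the support of `a`.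
  let 𝒮 : Finset (V →₀ ℕ) :=
    Finset.univ.biUnion fun S => (v S).support.image fun c => c + squarefreeExponent S
  let W : Finset V → MvPolynomial V k := fun S =>
    ∑ a ∈ 𝒮, monomial (a - squarefreeExponent S) (w a S)
  have hW (a : V →₀ ℕ) : strand W a = if a ∈ 𝒮 then w a else 0 := by
    ext S
    rw [strand]
    by_cases hS : S ⊆ a.support
    · rw [if_pos hS, coeff_sum, ← Finset.sum_ite_eq' 𝒮 a w, Finset.sum_apply]
      refine Finset.sum_congr rfl fun b _ => ?_
      rw [coeff_monomial]
      by_cases hb : S ⊆ b.support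
      · have h : b - squarefreeExponent S = a - squarefreeExponent S ↔ b = a :=
          tsub_left_inj (squarefreeExponent_le_iff.2 hb) (squarefreeExponent_le_iff.2 hS)
        simp only [h]
        split_ifs <;> rfl
      · rw [hwL b S fun hc => hb hc.2]
        split_ifs <;> simp [hwL b S fun hc => hb hc.2]
    · rw [if_neg hS]
      split_ifs
      · rw [hwL a S fun hc => hS hc.2]
      · rfl
  refine ⟨W, fun S hS => ?_, fun T hT => ?_⟩
  · exact Finset.sum_eq_zero fun a _ => by rw [hwL a S fun hc => hS hc.1, monomial_zero]
  · ext c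
    have hle : squarefreeExponent T ≤ c + squarefreeExponent T := le_add_self
    have h := weightedBoundary_strand (ρ := ρ) W (squarefreeExponent_le_iff.1 hle)
    have hv : strand v (c + squarefreeExponent T) T = coeff c (v T) := by
      rw [strand, if_pos (squarefreeExponent_le_iff.1 hle), add_tsub_cancel_right]
    rw [add_tsub_cancel_right] at h
    rw [← h, hW]
    split_ifs with ha
    · rw [hwd _ T hT, hv]
    · rw [map_zero, Pi.zero_apply]
      by_contra hc
      refine ha (Finset.mem_biUnion.2 ⟨T, Finset.mem_univ _, Finset.mem_image.2 ⟨c, ?_, rfl⟩⟩)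
      rw [mem_support_iff]
      exact Ne.symm hc

end Strand

/-! ### The cellular resolution -/

section CellularResolution

variable {V : Type*} [Fintype V] [DecidableEq V] {k : Type*} [Field k]

/-- If all restrictions `{S ∈ L | S ⊆ B}` of the simplicial complex `L` are acyclic relative to
`N`, then the cells `S` of `L` with `N S` support a minimal multigraded resolution. -/
theorem exists_minimalMultigradedResolution {ρ : V → ℕ} (hρ : Function.Injective ρ)
    {N : Finset V → Prop} [DecidablePred N] {m : ℕ} (hN : ∀ ⦃S T⦄, S ⊆ T → N S → N T)
    (hcard : ∀ S, N S → m ≤ S.card)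
    (hm : ∀ S, N S → S.card = m + 1 → ∑ x ∈ S,
      (if N (S.erase x) then boundarySign (MvPolynomial V k) ρ x (S.erase x) else 0) = 0)
    {L : Finset V → Prop} (hL : ∀ ⦃S T⦄, S ⊆ T → L T → L S)
    (hA : ∀ B, IsAcyclicOn k ρ N m fun S => L S ∧ S ⊆ B)
    {I : Ideal (MvPolynomial V k)}
    (hI : I = Ideal.span {u | ∃ S, N S ∧ L S ∧ S.card = m ∧ u = ∏ x ∈ S, X x}) :
    ∃ G : MinimalMultigradedResolution I, ∀ t (a : V → ℤ), (∃ j, G.shift t j = a) ↔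
      ∃ S, N S ∧ L S ∧ S.card = m + t ∧ ∀ x, a x = squarefreeExponent S x := by
  classical
  let R := MvPolynomial V k
  let cells (t : ℕ) : Finset (Finset V) := {S | N S ∧ L S ∧ S.card = m + t}
  let r (t : ℕ) : ℕ := (cells t).card
  let s (t : ℕ) (j : Fin (r t)) : Finset V := ((cells t).equivFin.symm j).1
  have hs_inj (t) : Function.Injective (s t) :=
    Subtype.val_injective.comp (cells t).equivFin.symm.injective
  have hs_mem (t j) : N (s t j) ∧ L (s t j) ∧ (s t j).card = m + t :=
    (Finset.mem_filter.1 ((cells t).equivFin.symm j).2).2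
  have hs_surj (t S) (hN : N S) (hL : L S) (hc : S.card = m + t) : ∃ j, s t j = S := by
    have h : S ∈ cells t := by simp [cells, hN, hL, hc]
    exact ⟨(cells t).equivFin ⟨S, h⟩, by simp [s]⟩
  -- Coordinate vectors are treated as chains on all subsets of `V`, extended by zero, so that the
  -- identities for `weightedBoundary` apply directly.
  let ext (t : ℕ) : (Fin (r t) → R) →ₗ[R] (Finset V → R) := Function.ExtendByZero.linearMap R (s t)
  have ext_s (t v j) : ext t v (s t j) = v j := (hs_inj t).extend_apply _ _ _
  have ext_not (t v S) (h : ¬ (N S ∧ L S ∧ S.card = m + t)) : ext t v S = 0 := by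
    refine Function.extend_apply' _ _ _ ?_
    rintro ⟨j, rfl⟩
    exact h (hs_mem t j)
  let D : (Finset V → R) →ₗ[R] (Finset V → R) := weightedBoundary ρ X
  let d (t : ℕ) : (Fin (r (t + 1)) → R) →ₗ[R] (Fin (r t) → R) :=
    LinearMap.funLeft R R (s t) ∘ₗ D ∘ₗ ext (t + 1)
  have d_apply (t v j) : d t v j = D (ext (t + 1) v) (s t j) := rfl
  let ε' : (Finset V → R) →ₗ[R] R :=
    ∑ S with N S ∧ S.card = m, (∏ x ∈ S, (X x : R)) • LinearMap.proj S
  have ε'_apply (u) : ε' u = ∑ S with N S ∧ S.card = m, u S * ∏ x ∈ S, (X x : R) := by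
    simp [ε', LinearMap.sum_apply, mul_comm]
  let ε : (Fin (r 0) → R) →ₗ[R] R := ε' ∘ₗ ext 0
  have ε_apply (v) : ε v = ∑ j, v j * ∏ x ∈ s 0 j, (X x : R) := by
    change ε' (ext 0 v) = _
    rw [ε'_apply]
    symm
    refine Finset.sum_of_injOn (s 0) (hs_inj 0).injOn ?_ ?_ ?_
    · intro j _
      simpa using ⟨(hs_mem 0 j).1, (hs_mem 0 j).2.2⟩
    · intro S _ hS
      rw [ext_not, zero_mul]
      rintro ⟨h1, h2, h3⟩
      obtain ⟨j, rfl⟩ := hs_surj 0 S h1 h2 h3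
      exact hS ⟨j, by simp, rfl⟩
    · intro j _
      rw [ext_s]
  -- No boundary term over `N` is lost by restricting to cells: if `T` is not in `L` or has the
  -- wrong size, the same holds for its cofaces, and both sides vanish.
  have ext_d (t v T) (hT : N T) : ext t (d t v) T = D (ext (t + 1) v) T := by
    by_cases h : L T ∧ T.card = m + t
    · obtain ⟨j, rfl⟩ := hs_surj t T hT h.1 h.2
      rw [ext_s, d_apply]
    · rw [ext_not _ _ _ fun hc => h hc.2]
      symm
      refine Finset.sum_eq_zero fun x hx => ?_
      rw [ext_not _ _ _, mul_zero, mul_zero]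
      rintro ⟨-, h1, h2⟩
      rw [Finset.card_insert_of_notMem (Finset.mem_compl.1 hx)] at h2
      exact h ⟨hL (Finset.subset_insert _ _) h1, by omega⟩
  have d_d (t v) : d t (d (t + 1) v) = 0 := by
    ext1 j
    rw [d_apply]
    change weightedBoundary ρ X _ _ = _
    rw [weightedBoundary_congr (w := D (ext (t + 2) v)), weightedBoundary_weightedBoundary hρ]
    · rfl
    · exact fun x _ => ext_d _ _ _ (hN (Finset.subset_insert _ _) (hs_mem t j).1)
  have ε_d (v) : ε (d 0 v) = 0 := by
    change ε' (ext 0 (d 0 v)) = 0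
    rw [ε'_apply, ← sum_weightedBoundary_eq_zero hN hm (ext 1 v)]
    refine Finset.sum_congr rfl fun T hT => ?_
    rw [ext_d 0 v T (Finset.mem_filter.1 hT).2.1]
  have exact_of (t) (v : Fin (r t) → R) (h1 : ∀ T, N T → D (ext t v) T = 0)
      (h2 : ε' (ext t v) = 0) : v ∈ LinearMap.range (d t) := by
    obtain ⟨w, hwL, hw⟩ := exists_weightedBoundary_eq hA (ext t v)
      (fun S hS => ext_not _ _ _ fun hc => hS hc.2.1) h1 (by rw [← ε'_apply, h2])
    refine ⟨fun j => w (s (t + 1) j), ?_⟩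
    ext1 j
    rw [d_apply, ← ext_s t v j, ← hw _ (hs_mem t j).1]
    refine weightedBoundary_congr fun x hx => ?_
    by_cases h : L (insert x (s t j))
    · obtain ⟨i, hi⟩ := hs_surj (t + 1) (insert x (s t j))
        (hN (Finset.subset_insert _ _) (hs_mem t j).1) h (by
          rw [Finset.card_insert_of_notMem hx, (hs_mem t j).2.2, add_assoc])
      rw [← hi, ext_s]
    · rw [hwL _ h, ext_not _ _ _ fun hc => h hc.2.1]
  have d_term (t v j c) (hc : c ∈ (d t v j).support) : ∃ x ∉ s t j, x ∈ c.support ∧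
      c - Finsupp.single x 1 ∈ (ext (t + 1) v (insert x (s t j))).support := by
    obtain ⟨x, hx, h⟩ := Finset.mem_biUnion.1 (support_sum hc)
    refine ⟨x, Finset.mem_compl.1 hx, ?_⟩
    rw [mem_support_iff, boundarySign_mvPolynomial, coeff_C_mul, coeff_X_mul'] at h
    have h' := right_ne_zero_of_mul h
    rw [ite_ne_right_iff] at h'
    exact ⟨h'.1, mem_support_iff.2 h'.2⟩
  let G : MinimalMultigradedResolution I :=
    { rank := r
      shift := fun t j x => squarefreeExponent (s t j) x
      d := d
      ε := ε
      finite_length := by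
        refine ⟨Fintype.card V, fun i hi => ?_⟩
        rw [Finset.card_eq_zero, Finset.filter_eq_empty_iff]
        rintro S - ⟨-, -, h⟩
        have := Finset.card_le_univ S
        omega
      d_graded := by
        intro t a v hv j c hc x
        obtain ⟨y, hy, hyc, h⟩ := d_term t v j c hc
        have hne : ext (t + 1) v (insert y (s t j)) ≠ 0 := by
          intro h0
          rw [h0] at h
          simp at h
        obtain ⟨i, hi⟩ : ∃ i, s (t + 1) i = insert y (s t j) := by
          by_contra hi
          refine hne (ext_not _ _ _ fun hc => hi (hs_surj _ _ hc.1 hc.2.1 hc.2.2))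
        rw [← hi, ext_s] at h
        have h1 := hv i _ h x
        simp only [hi, squarefreeExponent_insert hy] at h1
        rw [← h1]
        have h2 : c = c - Finsupp.single y 1 + Finsupp.single y 1 := by
          rw [tsub_add_cancel_of_le]
          rw [Finsupp.single_le_iff]
          rw [Finsupp.mem_support_iff] at hyc
          omega
        conv_lhs => rw [h2]
        simp only [Finsupp.add_apply]
        push_cast
        ring
      ε_graded := by
        intro a v hv c hc x
        rw [ε_apply] at hc
        obtain ⟨j, -, h⟩ := Finset.mem_biUnion.1 (support_sum hc)
        rw [← monomial_squarefreeExponent, mem_support_iff, coeff_mul_monomial', mul_one,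
          ite_ne_right_iff] at h
        rw [← hv j _ (mem_support_iff.2 h.2) x]
        have := h.1 x
        change _ = (((c - squarefreeExponent (s 0 j) : V →₀ ℕ) x : ℕ) : ℤ) +
          ((squarefreeExponent (s 0 j) x : ℕ) : ℤ)
        rw [Finsupp.tsub_apply]
        omega
      range_ε := by
        rw [hI]
        apply le_antisymm
        · rintro _ ⟨v, rfl⟩
          rw [ε_apply]
          refine Ideal.sum_mem _ fun j _ => Ideal.mul_mem_left _ _ (Ideal.subset_span ?_)
          exact ⟨s 0 j, (hs_mem 0 j).1, (hs_mem 0 j).2.1, (hs_mem 0 j).2.2, rfl⟩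
        · refine Ideal.span_le.2 ?_
          rintro _ ⟨S, h1, h2, h3, rfl⟩
          obtain ⟨j, rfl⟩ := hs_surj 0 S h1 h2 h3
          refine ⟨Pi.single j 1, ?_⟩
          rw [ε_apply, Finset.sum_eq_single j]
          · simp
          · intro i _ hi
            simp [hi]
          · simp
      exact_zero := by
        apply le_antisymm
        · intro v hv
          refine exact_of 0 v (fun T hT => ?_) hv
          refine Finset.sum_eq_zero fun x hx => ?_
          rw [ext_not _ _ _, mul_zero, mul_zero]
          rintro ⟨-, -, h⟩
          rw [Finset.card_insert_of_notMem (Finset.mem_compl.1 hx)] at h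
          have := hcard T hT
          omega
        · rintro _ ⟨v, rfl⟩
          exact ε_d v
      exact_succ := by
        intro t
        apply le_antisymm
        · intro v hv
          have hv' : d t v = 0 := hv
          refine exact_of (t + 1) v (fun T hT => ?_) ?_
          · rw [← ext_d t v T hT, hv', map_zero, Pi.zero_apply]
          · rw [ε'_apply]
            refine Finset.sum_eq_zero fun S hS => ?_
            rw [ext_not _ _ _, zero_mul]
            rintro ⟨-, -, h⟩
            have := (Finset.mem_filter.1 hS).2.2
            omega
        · rintro _ ⟨v, rfl⟩
          exact d_d t v
      minimal := by
        intro t v j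
        rw [mem_idealOfVars_iff_coeff_zero, ← notMem_support_iff]
        intro h
        obtain ⟨x, -, hx, -⟩ := d_term t v j 0 h
        simp at hx }
  refine ⟨G, fun t a => ⟨?_, ?_⟩⟩
  · rintro ⟨j, rfl⟩
    exact ⟨s t j, (hs_mem t j).1, (hs_mem t j).2.1, (hs_mem t j).2.2, fun x => rfl⟩
  · rintro ⟨S, h1, h2, h3, h4⟩
    obtain ⟨j, rfl⟩ := hs_surj t S h1 h2 h3
    exact ⟨j, funext fun x => (h4 x).symm⟩

end CellularResolution

/-! ### Co-letterplace cells and their acyclicity -/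

section Cells

variable {P : Type*} [PartialOrder P] [Fintype P] [DecidableEq P] {n : ℕ}

/-- A set of vertices that meets all fibres of the projection to `P`. -/
def MeetsFibers (S : Finset (P × Fin n)) : Prop := ∀ p, ∃ a, (p, a) ∈ S

/-- The simplicial complex whose members that meet all fibres are the sets `⋃ p, {p} × K p` with
`max K p ≤ min K q` for `p < q` and `(max K p)_p ∈ 𝔄`. -/
def IsColetterplaceFace {𝒜 : P → Finset (Fin n)} (𝔄 : Set (IsotoneHom 𝒜))
    (S : Finset (P × Fin n)) : Prop :=
  (∀ x ∈ S, x.2 ∈ 𝒜 x.1) ∧ (∀ x ∈ S, ∀ y ∈ S, x.1 < y.1 → x.2 ≤ y.2) ∧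
    ∃ f ∈ 𝔄, ∀ x ∈ S, x.2 ≤ f.1 x.1

/-- The graph of a map `P → [n]`. -/
def graphFinset (g : P → Fin n) : Finset (P × Fin n) := Finset.univ.image fun p => (p, g p)

omit [PartialOrder P] in
theorem mem_graphFinset {g : P → Fin n} {x : P × Fin n} : x ∈ graphFinset g ↔ x.2 = g x.1 := by
  simp only [graphFinset, Finset.mem_image, Finset.mem_univ, true_and, Prod.ext_iff]
  exact ⟨by rintro ⟨p, rfl, h⟩; exact h.symm, fun h => ⟨x.1, rfl, h.symm⟩⟩

omit [PartialOrder P] in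
theorem card_graphFinset (g : P → Fin n) : (graphFinset g).card = Fintype.card P := by
  rw [graphFinset, Finset.card_image_of_injective _ fun p q h => (Prod.ext_iff.1 h).1]
  rfl

omit [PartialOrder P] in
theorem meetsFibers_graphFinset (g : P → Fin n) : MeetsFibers (graphFinset g) :=
  fun p => ⟨g p, mem_graphFinset.2 rfl⟩

omit [PartialOrder P] in
theorem MeetsFibers.exists_graphFinset_subset {S : Finset (P × Fin n)} (hS : MeetsFibers S) :
    ∃ g, graphFinset g ⊆ S := by
  choose g hg using hS
  refine ⟨g, fun x hx => ?_⟩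
  have := hg x.1
  rwa [← mem_graphFinset.1 hx] at this

omit [PartialOrder P] in
theorem MeetsFibers.card_le {S : Finset (P × Fin n)} (hS : MeetsFibers S) :
    Fintype.card P ≤ S.card := by
  obtain ⟨g, hg⟩ := hS.exists_graphFinset_subset
  rw [← card_graphFinset g]
  exact Finset.card_le_card hg

omit [PartialOrder P] [Fintype P] [DecidableEq P] in
theorem MeetsFibers.mono {S T : Finset (P × Fin n)} (h : S ⊆ T) (hS : MeetsFibers S) :
    MeetsFibers T := fun p => (hS p).imp fun _ ha => h ha

omit [Fintype P] [DecidableEq P] in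
theorem IsColetterplaceFace.anti {𝒜 : P → Finset (Fin n)} {𝔄 : Set (IsotoneHom 𝒜)}
    {S T : Finset (P × Fin n)} (h : S ⊆ T) (hT : IsColetterplaceFace 𝔄 T) :
    IsColetterplaceFace 𝔄 S := by
  obtain ⟨h1, h2, f, hf, hf'⟩ := hT
  exact ⟨fun x hx => h1 x (h hx), fun x hx y hy => h2 x (h hx) y (h hy), f, hf,
    fun x hx => hf' x (h hx)⟩

-- The face condition only asks for a bound in `𝔄`, which passes to subsets. Down-closedness turns
-- it into membership of the map of maxima.
omit [Fintype P] [DecidableEq P] in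
theorem IsColetterplaceFace.mem_of_forall {𝒜 : P → Finset (Fin n)} {𝔄 : Set (IsotoneHom 𝒜)}
    (h𝔄 : IsLowerSet 𝔄) {S : Finset (P × Fin n)} (hS : IsColetterplaceFace 𝔄 S)
    {f : IsotoneHom 𝒜} (hf : ∀ p, (p, f.1 p) ∈ S) : f ∈ 𝔄 := by
  obtain ⟨-, -, g, hg, hg'⟩ := hS
  exact h𝔄 (show f ≤ g from fun p => hg' _ (hf p)) hg

/-- The position of `(p, a)` in the lexicographic order induced by `l : P → ℕ`. -/
def lexPosition (l : P → ℕ) (x : P × Fin n) : ℕ := l x.1 * n + x.2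

-- Fibres occupy disjoint consecutive blocks of length `n`; this is what controls the signs of
-- edges.
omit [PartialOrder P] [Fintype P] [DecidableEq P] in
theorem lexPosition_lt {l : P → ℕ} {x y : P × Fin n} (h : l x.1 < l y.1) :
    lexPosition l x < lexPosition l y := by
  have h1 : (l x.1 + 1) * n ≤ l y.1 * n := Nat.mul_le_mul_right n h
  have h2 := x.2.isLt
  rw [add_mul, one_mul] at h1
  unfold lexPosition
  omega

omit [PartialOrder P] [Fintype P] [DecidableEq P] in
theorem lexPosition_injective {l : P → ℕ} (hl : Function.Injective l) :
    Function.Injective (lexPosition l : P × Fin n → ℕ) := by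
  intro x y h
  rcases lt_trichotomy (l x.1) (l y.1) with h1 | h1 | h1
  · exact absurd h (lexPosition_lt h1).ne
  · have h2 := hl h1
    refine Prod.ext h2 (Fin.ext ?_)
    unfold lexPosition at h
    rw [h1] at h
    omega
  · exact absurd h (lexPosition_lt h1).ne'

omit [PartialOrder P] in
/-- The two faces of a one-dimensional cell have opposite signs. -/
theorem sum_boundarySign_eq_zero {A : Type*} [CommRing A] {l : P → ℕ} (hl : Function.Injective l)
    [DecidablePred (MeetsFibers : Finset (P × Fin n) → Prop)] {S : Finset (P × Fin n)}
    (hS : MeetsFibers S) (hcard : S.card = Fintype.card P + 1) :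
    ∑ x ∈ S, (if MeetsFibers (S.erase x) then boundarySign A (lexPosition l) x (S.erase x)
      else 0) = 0 := by
  obtain ⟨g, hg⟩ := hS.exists_graphFinset_subset
  obtain ⟨y, hyS, hyg⟩ := Finset.exists_mem_notMem_of_card_lt_card
    (show (graphFinset g).card < S.card by rw [card_graphFinset]; omega)
  obtain rfl : insert y (graphFinset g) = S :=
    Finset.eq_of_subset_of_card_le (Finset.insert_subset hyS hg) (by
      rw [Finset.card_insert_of_notMem hyg, card_graphFinset, hcard])
  set z : P × Fin n := (y.1, g y.1) with hz
  have hzg : z ∈ graphFinset g := mem_graphFinset.2 rfl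
  have hyz : y ≠ z := fun h => hyg (h ▸ hzg)
  set U := (graphFinset g).erase z with hU
  have hyU : y ∉ U := fun h => hyg (Finset.mem_of_mem_erase h)
  have hzU : z ∉ U := Finset.notMem_erase _ _
  have hins : insert z U = graphFinset g := Finset.insert_erase hzg
  have e1 : (insert y (graphFinset g)).erase y = insert z U := by
    rw [Finset.erase_insert hyg, hins]
  have e2 : (insert y (graphFinset g)).erase z = insert y U := by
    rw [Finset.erase_insert_of_ne hyz]
  have m1 : MeetsFibers (insert z U) := hins ▸ meetsFibers_graphFinset g
  have m2 : MeetsFibers (insert y U) := by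
    intro p
    by_cases hp : p = y.1
    · exact ⟨y.2, by rw [hp]; exact Finset.mem_insert_self _ _⟩
    · refine ⟨g p, Finset.mem_insert_of_mem (Finset.mem_erase.2 ⟨?_, mem_graphFinset.2 rfl⟩)⟩
      exact fun h => hp (Prod.ext_iff.1 h).1
  -- No element of `U` lies over `y.1`, so `y` and `z`, being in the same block, are preceded by the
  -- same elements of `U`. The signs at the two ends then differ only through the order of `y` and
  -- `z`.
  have hsign : boundarySign A (lexPosition l) y U = boundarySign A (lexPosition l) z U := by
    unfold boundarySign
    congr 2
    refine Finset.filter_congr fun u hu => ?_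
    have hu' : u.1 ≠ y.1 := by
      intro h
      have := mem_graphFinset.1 (Finset.mem_of_mem_erase hu)
      exact hzU ((Prod.ext h (by rw [this, h]) : u = z) ▸ hu)
    rcases lt_or_gt_of_ne (hl.ne hu') with h | h
    · exact iff_of_true (lexPosition_lt h) (lexPosition_lt h)
    · exact iff_of_false (lexPosition_lt h).not_gt
        (lexPosition_lt (x := z) h).not_gt
  rw [Finset.sum_eq_add_of_mem y z (Finset.mem_insert_self _ _) (Finset.mem_insert_of_mem hzg) hyz]
  · rw [e1, e2, if_pos m1, if_pos m2, boundarySign_insert hzU, boundarySign_insert hyU, hsign]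
    rcases lt_or_gt_of_ne ((lexPosition_injective hl).ne hyz) with h | h
    · rw [if_pos h, if_neg h.not_gt]; ring
    · rw [if_neg h.not_gt, if_pos h]; ring
  · rintro x hx ⟨hxy, hxz⟩
    refine if_neg fun hm => ?_
    obtain ⟨a, ha⟩ := hm x.1
    obtain ⟨ha1, ha2⟩ := Finset.mem_erase.1 ha
    have hxg : x.2 = g x.1 := mem_graphFinset.1 (Finset.mem_of_mem_insert_of_ne hx hxy)
    rcases Finset.mem_insert.1 ha2 with h | h
    · have h1 : x.1 = y.1 := (Prod.ext_iff.1 h).1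
      exact hxz (Prod.ext h1 (by rw [hxg, h1]))
    · exact ha1 (Prod.ext rfl ((mem_graphFinset.1 h).trans hxg.symm))

/-- The restrictions of the complex of co-letterplace faces are acyclic. -/
theorem isAcyclicOn_isColetterplaceFace {A : Type*} [CommRing A] {l : P → ℕ}
    (hl : Function.Injective l) (hmono : StrictMono l)
    [DecidablePred (MeetsFibers : Finset (P × Fin n) → Prop)]
    {𝒜 : P → Finset (Fin n)} (𝔄 : Set (IsotoneHom 𝒜)) (B : Finset (P × Fin n)) :
    IsAcyclicOn A (lexPosition l) MeetsFibers (Fintype.card P)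
      fun S => IsColetterplaceFace 𝔄 S ∧ S ⊆ B := by
  by_cases hex : ∃ S, MeetsFibers S ∧ IsColetterplaceFace 𝔄 S ∧ S ⊆ B
  swap
  · intro v hv _ _
    refine ⟨0, fun _ _ => rfl, fun T hT => ?_⟩
    rw [map_zero, hv T fun h => hex ⟨T, hT, h⟩, Pi.zero_apply]
  have hmin (p : P) : ∃ a, (∃ S, MeetsFibers S ∧ (IsColetterplaceFace 𝔄 S ∧ S ⊆ B) ∧ (p, a) ∈ S) ∧
      ∀ S, MeetsFibers S → IsColetterplaceFace 𝔄 S → S ⊆ B → ∀ b, (p, b) ∈ S → a ≤ b := by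
    obtain ⟨S, hS, hS'⟩ := hex
    obtain ⟨a, ha⟩ := hS p
    obtain ⟨b, hb, hb'⟩ := Set.exists_min_image
      {a | ∃ S, MeetsFibers S ∧ (IsColetterplaceFace 𝔄 S ∧ S ⊆ B) ∧ (p, a) ∈ S} id
      (Set.toFinite _) ⟨a, S, hS, hS', ha⟩
    exact ⟨b, hb, fun S h1 h2 h3 c hc => hb' c ⟨S, h1, ⟨h2, h3⟩, hc⟩⟩
  choose f₀ hf₀ hf₀_le using hmin
  have hf₀_mono {p q : P} (h : p < q) : f₀ p ≤ f₀ q := by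
    obtain ⟨S, hS, hS', hq⟩ := hf₀ q
    obtain ⟨b, hb⟩ := hS p
    exact (hf₀_le p S hS hS'.1 hS'.2 b hb).trans (hS'.1.2.1 _ hb _ hq h)
  -- Filtration by the cells that agree with `f₀` over the first elements of the linear extension.
  -- The induction descends from `j ≥ M`, where all of `P` is covered.
  let L (j : ℕ) (S : Finset (P × Fin n)) : Prop :=
    (IsColetterplaceFace 𝔄 S ∧ S ⊆ B) ∧ ∀ x ∈ S, l x.1 < j → x.2 = f₀ x.1
  have hL (j) ⦃S T : Finset (P × Fin n)⦄ (h : S ⊆ T) (hT : L j T) : L j S :=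
    ⟨⟨hT.1.1.anti h, h.trans hT.1.2⟩, fun x hx => hT.2 x (h hx)⟩
  obtain ⟨M, hM⟩ : ∃ M, ∀ p, l p < M :=
    ⟨Finset.univ.sup l + 1, fun p => Nat.lt_succ_of_le (Finset.le_sup (Finset.mem_univ p))⟩
  have key (i : ℕ) : ∀ j, M ≤ j + i →
      IsAcyclicOn A (lexPosition l) MeetsFibers (Fintype.card P) (L j) := by
    induction i with
    | zero =>
      intro j hj v hv _ hv0
      have hgraph (T) (hT : MeetsFibers T) (hTL : L j T) : T = graphFinset f₀ := by
        have hsub : T ⊆ graphFinset f₀ := fun x hx =>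
          mem_graphFinset.2 (hTL.2 x hx ((hM x.1).trans_le hj))
        exact Finset.eq_of_subset_of_card_le hsub (by rw [card_graphFinset]; exact hT.card_le)
      have hvT (T) (hT : MeetsFibers T) (hne : T ≠ graphFinset f₀) : v T = 0 :=
        hv T fun h => hne (hgraph T hT h)
      -- At most the graph of `f₀` is left, and the augmentation condition kills its coefficient.
      refine ⟨0, fun _ _ => rfl, fun T hT => ?_⟩
      rw [map_zero, Pi.zero_apply]
      by_cases hne : T = graphFinset f₀
      · rw [Finset.sum_eq_single_of_mem (graphFinset f₀)] at hv0
        · rw [hne, hv0]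
        · simp [meetsFibers_graphFinset, card_graphFinset]
        · exact fun S hS => hvT S (Finset.mem_filter.1 hS).2.1
      · rw [hvT T hT hne]
    | succ i ih =>
      intro j hj
      have ih' := ih (j + 1) (by omega)
      have hle (S) (h : L (j + 1) S) : L j S := ⟨h.1, fun x hx hxj => h.2 x hx (by omega)⟩
      by_cases hp : ∃ p, l p = j
      swap
      · have hLj : L j = L (j + 1) := by
          ext S
          refine ⟨fun h => ⟨h.1, fun x hx hxj => h.2 x hx ?_⟩, hle S⟩
          have : l x.1 ≠ j := fun h => hp ⟨x.1, h⟩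
          omega
        rw [hLj]
        exact ih'
      obtain ⟨p, rfl⟩ := hp
      refine IsAcyclicOn.of_matching (lexPosition_injective hl) (fun S T => MeetsFibers.mono)
        (fun S hS hc => sum_boundarySign_eq_zero hl hS hc) (hL _) (hL _) hle (p, f₀ p) ?_ ih'
      intro S hS hSL hSL'
      obtain ⟨a, haS, ha⟩ : ∃ a, (p, a) ∈ S ∧ a ≠ f₀ p := by
        by_contra! hc
        refine hSL' ⟨hSL.1, fun x hx hxj => ?_⟩
        rcases Nat.lt_succ_iff_lt_or_eq.1 hxj with h | h
        · exact hSL.2 x hx h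
        · have hxp := hl h
          have := hc x.2 (by rw [← hxp]; exact hx)
          rw [this, hxp]
      have hle_a : f₀ p ≤ a := hf₀_le p S hS hSL.1.1 hSL.1.2 a haS
      obtain ⟨⟨⟨h1, h2, f, hf, hf'⟩, h3⟩, h4⟩ := hSL
      obtain ⟨S', -, ⟨hS'L, hS'B⟩, hpS'⟩ := hf₀ p
      refine ⟨⟨⟨⟨?_, ?_, f, hf, ?_⟩, ?_⟩, ?_⟩, ?_, ?_⟩
      · intro x hx
        rcases Finset.mem_insert.1 hx with rfl | hx
        · exact hS'L.1 _ hpS'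
        · exact h1 x hx
      -- Inserting `(p, f₀ p)` respects the order: upwards because `f₀ p ≤ a` and `a` already
      -- satisfies the inequalities, downwards because elements below `p` come earlier in the linear
      -- extension, where `S` agrees with the isotone `f₀`.
      · intro x hx y hy hxy
        rcases Finset.mem_insert.1 hx with rfl | hx <;> rcases Finset.mem_insert.1 hy with rfl | hy
        · exact le_rfl
        · exact hle_a.trans (h2 _ haS y hy hxy)
        · rw [h4 x hx (hmono hxy)]
          exact hf₀_mono hxy
        · exact h2 x hx y hy hxy
      · intro x hx
        rcases Finset.mem_insert.1 hx with rfl | hx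
        · exact hle_a.trans (hf' _ haS)
        · exact hf' x hx
      · exact Finset.insert_subset (hS'B hpS') h3
      · intro x hx hxj
        rcases Finset.mem_insert.1 hx with rfl | hx
        · rfl
        · exact h4 x hx hxj
      · intro q
        by_cases hq : q = p
        · exact ⟨a, Finset.mem_erase.2 ⟨fun h => ha (Prod.ext_iff.1 h).2, hq ▸ haS⟩⟩
        · obtain ⟨b, hb⟩ := hS q
          exact ⟨b, Finset.mem_erase.2 ⟨fun h => hq (Prod.ext_iff.1 h).1, hb⟩⟩
      · intro hc
        exact ha (hc.2 (p, a) (Finset.mem_erase.2 ⟨fun h => ha (Prod.ext_iff.1 h).2, haS⟩)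
          (Nat.lt_succ_self _))
  have h0 := key M 0 (by omega)
  have hL0 : L 0 = fun S => IsColetterplaceFace 𝔄 S ∧ S ⊆ B := by
    ext S
    exact ⟨fun h => h.1, fun h => ⟨h, fun x _ hx => absurd hx (Nat.not_lt_zero _)⟩⟩
  rwa [hL0] at h0

end Cells

/-! ### From a resolution to minimal generators -/

/-- Distinct monomials of the same degree form a minimal generating set. -/
theorem isMinimalMonomialGeneratingSet_of_degree_eq {σ : Type*} {k : Type*} [Field k]
    {E : Set (σ →₀ ℕ)} {d : ℕ} (hE : ∀ c ∈ E, c.degree = d) :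
    IsMinimalMonomialGeneratingSet (Ideal.span ((fun c => monomial c (1 : k)) '' E))
      ((fun c => monomial c (1 : k)) '' E) := by
  classical
  refine ⟨⟨?_, rfl⟩, ?_⟩
  · rintro _ ⟨c, -, rfl⟩
    exact ⟨c, rfl⟩
  · rintro T ⟨hT, hspan⟩ _ ⟨c, hc, rfl⟩
    obtain ⟨E', rfl⟩ : ∃ E' : Set (σ →₀ ℕ), T = (fun c => monomial c (1 : k)) '' E' := by
      refine ⟨{c | monomial c 1 ∈ T}, Set.Subset.antisymm (fun u hu => ?_) ?_⟩
      · obtain ⟨b, rfl⟩ := hT u hu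
        exact ⟨b, hu, rfl⟩
      · rintro _ ⟨b, hb, rfl⟩
        exact hb
    have exists_le {F F' : Set (σ →₀ ℕ)}
        (h : Ideal.span ((fun c => monomial c (1 : k)) '' F) ≤
          Ideal.span ((fun c => monomial c (1 : k)) '' F')) {b : σ →₀ ℕ} (hb : b ∈ F) :
        ∃ b' ∈ F', b' ≤ b :=
      mem_ideal_span_monomial_image.1 (h (Ideal.subset_span ⟨b, hb, rfl⟩)) b
        (by simp [support_monomial])
    -- Divisibility gives `c' ≤ b ≤ c` with `c'` and `c` of the same degree, so `b = c`.
    obtain ⟨b, hb, hbc⟩ := exists_le hspan.ge hc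
    obtain ⟨c', hc', hcb⟩ := exists_le hspan.le hb
    have h1 : b.degree ≤ d := hE c hc ▸ Finsupp.degree_mono hbc
    have h2 : d ≤ b.degree := hE c' hc' ▸ Finsupp.degree_mono hcb
    obtain ⟨e, rfl⟩ := exists_add_of_le hbc
    have h3 : e = 0 := by
      have := hE _ hc
      rw [map_add] at this
      exact (Finsupp.degree_eq_zero_iff e).1 (by omega)
    exact ⟨b, hb, by rw [h3, add_zero]⟩

theorem homologicalShiftIdeal_eq {σ : Type*} {k : Type*} [Field k] {I : Ideal (MvPolynomial σ k)}
    (G : MinimalMultigradedResolution I) (t : ℕ) {E : Set (σ →₀ ℕ)}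
    (hG : ∀ a : σ → ℤ, (∃ j, G.shift t j = a) ↔ ∃ c ∈ E, ∀ s, a s = (c s : ℤ)) :
    homologicalShiftIdeal t I = Ideal.span ((fun c => monomial c (1 : k)) '' E) := by
  unfold homologicalShiftIdeal
  congr 1
  ext u
  constructor
  · rintro ⟨F, j, c, hc, rfl⟩
    obtain ⟨i, hi⟩ := F.exists_shift_eq G t j
    obtain ⟨c', hc', h⟩ := (hG _).1 ⟨i, hi⟩
    refine ⟨c', hc', ?_⟩
    have : c' = c := Finsupp.ext fun s => by
      have := (h s).symm.trans (hc s)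
      exact_mod_cast this
    rw [this]
  · rintro ⟨c, hc, rfl⟩
    obtain ⟨j, hj⟩ := (hG fun s => (c s : ℤ)).2 ⟨c, hc, fun _ => rfl⟩
    exact ⟨G, j, c, fun s => congrFun hj s, rfl⟩

theorem exists_strictMono_nat (P : Type*) [PartialOrder P] [Fintype P] :
    ∃ l : P → ℕ, Function.Injective l ∧ StrictMono l := by
  classical
  have : Fintype (LinearExtension P) := ‹Fintype P›
  let e := (Fintype.orderIsoFinOfCardEq (LinearExtension P) rfl).symm
  have hinj : Function.Injective fun p : P => (e (toLinearExtension p) : ℕ) :=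
    Fin.val_injective.comp (e.injective.comp fun _ _ h => h)
  refine ⟨_, hinj, Monotone.strictMono_of_injective (fun p q h => ?_) hinj⟩
  exact e.monotone (toLinearExtension.monotone h)

/-! ### Translation to the ideal and the sets `K p` -/

section Main

variable {P : Type*} [PartialOrder P] [Fintype P] [DecidableEq P] {n : ℕ}
  {𝒜 : P → Finset (Fin n)} {𝔄 : Set (IsotoneHom 𝒜)}

/-- A set of `|P|` elements that meets every fibre is a graph, and the graphs that are faces are
those of members of `𝔄`. -/
theorem coLetterplaceIdeal_eq (k : Type*) [Field k] (h𝔄 : IsLowerSet 𝔄) :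
    coLetterplaceIdeal k 𝔄 = Ideal.span {u | ∃ S, MeetsFibers S ∧ IsColetterplaceFace 𝔄 S ∧
      S.card = Fintype.card P ∧ u = ∏ x ∈ S, X x} := by
  have hprod (g : P → Fin n) :
      ∏ x ∈ graphFinset g, (X x : MvPolynomial (P × Fin n) k) = ∏ p, X (p, g p) :=
    Finset.prod_image fun p _ q _ h => (Prod.ext_iff.1 h).1
  unfold coLetterplaceIdeal
  congr 1
  ext u
  constructor
  · rintro ⟨f, hf, rfl⟩
    refine ⟨graphFinset f.1, meetsFibers_graphFinset _, ⟨?_, ?_, f, hf, ?_⟩,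
      card_graphFinset _, (hprod _).symm⟩
    · intro x hx
      rw [mem_graphFinset.1 hx]
      exact f.2 _
    · intro x hx y hy h
      rw [mem_graphFinset.1 hx, mem_graphFinset.1 hy]
      exact f.1.monotone h.le
    · exact fun x hx => (mem_graphFinset.1 hx).le
  · rintro ⟨S, hS, hS', hc, rfl⟩
    obtain ⟨g, hg⟩ := hS.exists_graphFinset_subset
    obtain rfl : graphFinset g = S :=
      Finset.eq_of_subset_of_card_le hg (by rw [card_graphFinset, hc])
    have hgm (p) : (p, g p) ∈ graphFinset g := mem_graphFinset.2 rfl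
    let f : IsotoneHom 𝒜 := ⟨⟨g, fun p q h => by
      rcases h.eq_or_lt with rfl | h
      · exact le_rfl
      · exact hS'.2.1 _ (hgm p) _ (hgm q) h⟩, fun p => hS'.1 _ (hgm p)⟩
    exact ⟨f, hS'.mem_of_forall h𝔄 hgm, hprod g⟩

/-- `S` and `K` determine each other as set and fibres. The map of maxima is isotone because `max K
p ≤ min K q ≤ max K q` for `p < q`. -/
theorem setOf_monomials_eq (k : Type*) [Field k] (h𝔄 : IsLowerSet 𝔄) (t : ℕ) :
    {u : MvPolynomial (P × Fin n) k | ∃ (K : P → Finset (Fin n)) (hK : ∀ p, (K p).Nonempty),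
        (∀ p, K p ⊆ 𝒜 p) ∧
        (∀ p q, p < q → (K p).max' (hK p) ≤ (K q).min' (hK q)) ∧
        ∑ p, (K p).card = Fintype.card P + t ∧
        (∃ f ∈ 𝔄, ∀ p, f.1 p = (K p).max' (hK p)) ∧
        u = ∏ p, ∏ a ∈ K p, X (p, a)} =
      (fun c => monomial c (1 : k)) '' {c | ∃ S, MeetsFibers S ∧ IsColetterplaceFace 𝔄 S ∧
        S.card = Fintype.card P + t ∧ c = squarefreeExponent S} := by
  have hcardK (S : Finset (P × Fin n)) (K : P → Finset (Fin n))
      (h : ∀ x, x ∈ S ↔ x.2 ∈ K x.1) : S.card = ∑ p, (K p).card := by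
    rw [Finset.card_eq_sum_ones, Finset.sum_finset_product S Finset.univ K (by simpa using h)]
    simp
  have hprodK (S : Finset (P × Fin n)) (K : P → Finset (Fin n))
      (h : ∀ x, x ∈ S ↔ x.2 ∈ K x.1) :
      monomial (squarefreeExponent S) (1 : k) = ∏ p, ∏ a ∈ K p, X (p, a) := by
    rw [monomial_squarefreeExponent,
      Finset.prod_finset_product S Finset.univ K (by simpa using h)]
  ext u
  constructor
  · rintro ⟨K, hK, h𝒜, hlt, hc, ⟨f, hf, hfK⟩, rfl⟩
    let S : Finset (P × Fin n) := {x | x.2 ∈ K x.1}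
    have hS (x) : x ∈ S ↔ x.2 ∈ K x.1 := by simp [S]
    refine ⟨_, ⟨S, ?_, ⟨?_, ?_, f, hf, ?_⟩, ?_, rfl⟩, hprodK S K hS⟩
    · exact fun p => ⟨_, (hS _).2 ((K p).max'_mem (hK p))⟩
    · exact fun x hx => h𝒜 _ ((hS x).1 hx)
    · exact fun x hx y hy h => (Finset.le_max' _ _ ((hS x).1 hx)).trans
        ((hlt _ _ h).trans (Finset.min'_le _ _ ((hS y).1 hy)))
    · exact fun x hx => (hfK x.1).symm ▸ Finset.le_max' _ _ ((hS x).1 hx)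
    · rw [hcardK S K hS, hc]
  · rintro ⟨_, ⟨S, hS, hS', hc, rfl⟩, rfl⟩
    let K (p : P) : Finset (Fin n) := {a | (p, a) ∈ S}
    have hSK (x) : x ∈ S ↔ x.2 ∈ K x.1 := by simp [K]
    have hK (p) : (K p).Nonempty := (hS p).imp fun a ha => (hSK (p, a)).1 ha
    have hmax (p) : (p, (K p).max' (hK p)) ∈ S := (hSK _).2 ((K p).max'_mem (hK p))
    have hmin (p) : (p, (K p).min' (hK p)) ∈ S := (hSK _).2 ((K p).min'_mem (hK p))
    have hlt (p q) (h : p < q) : (K p).max' (hK p) ≤ (K q).min' (hK q) :=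
      hS'.2.1 _ (hmax p) _ (hmin q) h
    let f : IsotoneHom 𝒜 := ⟨⟨fun p => (K p).max' (hK p), fun p q h => by
      rcases h.eq_or_lt with rfl | h
      · exact le_rfl
      · exact (hlt p q h).trans (Finset.min'_le_max' _ _)⟩, fun p => hS'.1 _ (hmax p)⟩
    exact ⟨K, hK, fun p a ha => hS'.1 (p, a) ((hSK (p, a)).2 ha), hlt,
      by rw [← hcardK S K hSK, hc], ⟨f, hS'.mem_of_forall h𝔄 hmax, fun p => rfl⟩, hprodK S K hSK⟩

end Main

theorem theorem3 {P : Type*} [PartialOrder P] [Fintype P] {n : ℕ} (k : Type*) [Field k]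
    (𝒜 : P → Finset (Fin n)) (𝔄 : Set (IsotoneHom 𝒜)) (h𝔄 : IsPosetIdeal 𝔄) (t : ℕ) :
    IsMinimalMonomialGeneratingSet (homologicalShiftIdeal t (coLetterplaceIdeal k 𝔄))
      {u | ∃ (K : P → Finset (Fin n)) (hK : ∀ p, (K p).Nonempty),
        (∀ p, K p ⊆ 𝒜 p) ∧
        (∀ p q, p < q → (K p).max' (hK p) ≤ (K q).min' (hK q)) ∧
        ∑ p, (K p).card = Fintype.card P + t ∧
        (∃ f ∈ 𝔄, ∀ p, f.1 p = (K p).max' (hK p)) ∧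
        u = ∏ p, ∏ a ∈ K p, X (p, a)} := by
  classical
  obtain ⟨l, hl, hmono⟩ := exists_strictMono_nat P
  obtain ⟨G, hG⟩ := exists_minimalMultigradedResolution (k := k)
    (lexPosition_injective (n := n) hl) (fun S T => MeetsFibers.mono)
    (fun S hS => hS.card_le) (fun S hS hc => sum_boundarySign_eq_zero hl hS hc)
    (fun S T => IsColetterplaceFace.anti) (isAcyclicOn_isColetterplaceFace hl hmono 𝔄)
    (coLetterplaceIdeal_eq k h𝔄.2)
  rw [setOf_monomials_eq k h𝔄.2 t, homologicalShiftIdeal_eq G t]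
  · refine isMinimalMonomialGeneratingSet_of_degree_eq (d := Fintype.card P + t) ?_
    rintro _ ⟨S, -, -, hc, rfl⟩
    simp [squarefreeExponent, hc]
  · intro a
    rw [hG]
    constructor
    · rintro ⟨S, h1, h2, h3, h4⟩
      exact ⟨_, ⟨S, h1, h2, h3, rfl⟩, h4⟩
    · rintro ⟨_, ⟨S, h1, h2, h3, rfl⟩, h4⟩
      exact ⟨S, h1, h2, h3, h4⟩
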